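/- Let $n\ge m\ge 5$ and $2\le k\le m$, and let $X$ be a Hermitian operator on $\mathbb{C}^m\otimes\mathbb{C}^n$ with operator Schmidt decomposition $X=\sum_{i=1}^{m^2}\mu_i\,A_i\otimes B_i$, where $\mu_1\ge\mu_2\ge\dots\ge\mu_{m^2}\ge 0$ and the families $(A_i)$ in $M_m(\mathbb{C})$ and $(B_i)$ in $M_n(\mathbb{C})$ are orthonormal for the Hilbert–Schmidt inner product $\operatorname{Tr}(A^\dagger B)$. For $j\ge 1$ let $S_j$ be the set of states of Schmidt number at most $j$, i.e. of finite convex combinations of projectors $|\psi\rangle\langle\psi|$ onto unit vectors $\psi$ of Schmidt rank at most $j$. A Hermitian operator $W$ is a $(k+1)$-Schmidt witness if $\operatorname{Tr}(W\sigma)\ge 0$ for all $\sigma\in S_k$ and $\operatorname{Tr}(W\rho)<0$ for at least one $\rho\in S_{k+1}$. Put $$P=\mu_1+\mu_2+\mu_4+\mu_6+\dots+\mu_{2k-2}=\mu_1+\sum_{j=1}^{k-1}\mu_{2j},\qquad p=\mu_{2k-1}+\mu_{4k-4}+\dots+\mu_{k^2-1}+\mu_{k^2}=\sum_{j=1}^{k}\mu_{k^2-(k-j)^2},$$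 $$\theta_{k+1}=P-\mu_{k^2}+\mu_{k^2}\,\frac{2(p-\mu_{k^2})}{P-2\mu_{k^2}+\sqrt{P^2-4\mu_{k^2}(P-p)}}$$ (with $\theta_{k+1}=0$ if $X=0$, the only case in which the denominator vanishes). Then: 1. The maximum $\lambda_{k+1}=\max\langle\Psi|X|\Psi\rangle$ over unit vectors $\Psi$ of Schmidt rank at most $k$ is attained. The operator $\lambda_{k+1}\mathbb{I}-X$ is optimal: for real $c$, $c\,\mathbb{I}-X$ has nonnegative expectation on all of $S_k$ if and only if $c\ge\lambda_{k+1}$. It is a $(k+1)$-Schmidt witness if and only if $\operatorname{Tr}(X\rho)>\lambda_{k+1}$ for some $\rho\in S_{k+1}$. 2. $\lambda_{k+1}\le\theta_{k+1}$. 3. Consequently $\operatorname{Tr}\big((\theta_{k+1}\mathbb{I}-X)\sigma\big)\ge 0$ for all $\sigma\in S_k$, and $\theta_{k+1}\mathbb{I}-X$ is a $(k+1)$-Schmidt witness if and only if it detects a state of $S_{k+1}$, i.e. $\operatorname{Tr}(X\rho)>\theta_{k+1}$ for some $\rho\in S_{k+1}$. -/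

import Mathlib

open scoped Matrix Kronecker

/-- The Hilbert-Schmidt inner product `Tr (A† B)`. -/
def hsInner {d : ℕ} (A B : Matrix (Fin d) (Fin d) ℂ) : ℂ := (Aᴴ * B).trace

/-- `X = ∑ μ_i A_i ⊗ B_i` (`i = 1, …, min (m²) (n²)`) is an operator Schmidt decomposition of `X`:
the `A_i` and the `B_i` are orthonormal for the Hilbert-Schmidt inner product, and
`μ_1 ≥ μ_2 ≥ … ≥ 0`. The index starts at `1`; values outside the range play no role. -/
structure IsOperatorSchmidtDecomposition {m n : ℕ}
    (X : Matrix (Fin m × Fin n) (Fin m × Fin n) ℂ) (μ : ℕ → ℝ)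
    (A : ℕ → Matrix (Fin m) (Fin m) ℂ) (B : ℕ → Matrix (Fin n) (Fin n) ℂ) : Prop where
  orthonormal_left : ∀ i ∈ Finset.Icc 1 (min (m ^ 2) (n ^ 2)),
    ∀ j ∈ Finset.Icc 1 (min (m ^ 2) (n ^ 2)), hsInner (A i) (A j) = if i = j then 1 else 0
  orthonormal_right : ∀ i ∈ Finset.Icc 1 (min (m ^ 2) (n ^ 2)),
    ∀ j ∈ Finset.Icc 1 (min (m ^ 2) (n ^ 2)), hsInner (B i) (B j) = if i = j then 1 else 0
  nonneg : ∀ i ∈ Finset.Icc 1 (min (m ^ 2) (n ^ 2)), 0 ≤ μ i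
  antitone : ∀ i ∈ Finset.Icc 1 (min (m ^ 2) (n ^ 2)),
    ∀ j ∈ Finset.Icc 1 (min (m ^ 2) (n ^ 2)), i ≤ j → μ j ≤ μ i
  eq_sum : X = ∑ i ∈ Finset.Icc 1 (min (m ^ 2) (n ^ 2)), (μ i : ℂ) • (A i ⊗ₖ B i)

/-- `μ_1 ≥ μ_2 ≥ …` are the operator Schmidt coefficients of `X`. -/
def IsOperatorSchmidtCoefficients {m n : ℕ}
    (X : Matrix (Fin m × Fin n) (Fin m × Fin n) ℂ) (μ : ℕ → ℝ) : Prop :=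
  ∃ A B, IsOperatorSchmidtDecomposition X μ A B

/-- `ψ` has a Schmidt decomposition `ψ = ∑ s_i u_i ⊗ v_i` with exactly `r` nonzero (positive)
Schmidt coefficients, the `u_i` and the `v_i` being orthonormal. -/
def HasSchmidtRank {m n : ℕ} (ψ : Fin m × Fin n → ℂ) (r : ℕ) : Prop :=
  ∃ (s : Fin r → ℝ) (u : Fin r → Fin m → ℂ) (v : Fin r → Fin n → ℂ),
    (∀ i, 0 < s i) ∧
    (∀ i j, star (u i) ⬝ᵥ u j = if i = j then 1 else 0) ∧
    (∀ i j, star (v i) ⬝ᵥ v j = if i = j then 1 else 0) ∧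
    ∀ a b, ψ (a, b) = ∑ i, (s i : ℂ) * (u i a * v i b)

/-- The pure states (unit vectors) of Schmidt rank at most `k`. -/
def pureSchmidtStates (m n k : ℕ) : Set (Fin m × Fin n → ℂ) :=
  {ψ | star ψ ⬝ᵥ ψ = 1 ∧ ∃ r ≤ k, HasSchmidtRank ψ r}

/-- `S_k`: the states `ρ = ∑ p_i |ψ_i⟩⟨ψ_i|` of Schmidt number at most `k`, that is, those with
some decomposition into pure states of Schmidt rank at most `k`. -/
def schmidtStates (m n k : ℕ) : Set (Matrix (Fin m × Fin n) (Fin m × Fin n) ℂ) :=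
  {ρ | ∃ (N : ℕ) (p : Fin N → ℝ) (ψ : Fin N → Fin m × Fin n → ℂ),
    (∀ i, 0 ≤ p i) ∧ ∑ i, p i = 1 ∧ (∀ i, ψ i ∈ pureSchmidtStates m n k) ∧
    ρ = ∑ i, (p i : ℂ) • Matrix.vecMulVec (ψ i) (star (ψ i))}

/-- `W` is nonnegative on `S_k`: `Tr (W σ) ≥ 0` for all `σ ∈ S_k`
(a real number for Hermitian `W`). -/
def NonnegOnSchmidtStates {m n : ℕ} (k : ℕ)
    (W : Matrix (Fin m × Fin n) (Fin m × Fin n) ℂ) : Prop :=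
  ∀ σ ∈ schmidtStates m n k, 0 ≤ (W * σ).trace.re

/-- A `k`-Schmidt witness: a Hermitian operator that is nonnegative on `S_{k-1}` and takes a
negative value on some state in `S_k`. -/
def IsSchmidtWitness {m n : ℕ} (k : ℕ)
    (W : Matrix (Fin m × Fin n) (Fin m × Fin n) ℂ) : Prop :=
  W.IsHermitian ∧ NonnegOnSchmidtStates (k - 1) W ∧
    ∃ ρ ∈ schmidtStates m n k, (W * ρ).trace.re < 0

/-- The set of values `⟨Ψ|X|Ψ⟩` over the pure states `Ψ` of Schmidt rank at most `k`. -/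
def schmidtExpectations {m n : ℕ} (k : ℕ)
    (X : Matrix (Fin m × Fin n) (Fin m × Fin n) ℂ) : Set ℝ :=
  {x | ∃ ψ ∈ pureSchmidtStates m n k, x = (star ψ ⬝ᵥ X *ᵥ ψ).re}

/-- The optimal coefficient `λ_{k+1} = max ⟨Ψ^k|X|Ψ^k⟩`. -/
noncomputable def optimalCoeff {m n : ℕ} (k : ℕ)
    (X : Matrix (Fin m × Fin n) (Fin m × Fin n) ℂ) : ℝ :=
  sSup (schmidtExpectations k X)

/-- `P = μ_1 + μ_2 + μ_4 + ⋯ + μ_{2k-2}`. -/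
def firstRowSum (k : ℕ) (μ : ℕ → ℝ) : ℝ :=
  μ 1 + ∑ j ∈ Finset.Icc 1 (k - 1), μ (2 * j)

/-- `p = μ_{2k-1} + μ_{4k-4} + ⋯ + μ_{k²-1} + μ_{k²}`; the `j`-th index is `k² - (k - j)²`. -/
def lastRowSum (k : ℕ) (μ : ℕ → ℝ) : ℝ :=
  ∑ j ∈ Finset.Icc 1 k, μ (k ^ 2 - (k - j) ^ 2)

/-- The bound `θ_{k+1}`. -/
noncomputable def thetaCoeff (k : ℕ) (μ : ℕ → ℝ) : ℝ :=
  firstRowSum k μ - μ (k ^ 2) +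
    μ (k ^ 2) * (2 * (lastRowSum k μ - μ (k ^ 2)) /
      (firstRowSum k μ - 2 * μ (k ^ 2) +
        √(firstRowSum k μ ^ 2 - 4 * μ (k ^ 2) * (firstRowSum k μ - lastRowSum k μ))))

/-! Write a unit vector of Schmidt rank at most `k` as `∑ s_a u_a ⊗ v_a` with `s` decreasing. Its
expectation value is at most `∑_{a,b} s_a s_b ∑_i μ_i T_{(a,b),i}`, where `T_{(a,b),i} =
|⟨u_a|A_i|u_b⟩| |⟨v_a|B_i|v_b⟩|`. Bessel's inequality in Hilbert-Schmidt space, applied once to the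
`A_i` and once to the operators `|u_a⟩⟨u_b|` (likewise on the right factor), together with `2xy ≤ x²
+ y²`, makes `T` doubly substochastic. By rearrangement (`sum_substochastic_le`) the inner sum may
be replaced by the single coefficient `μ_l`, with `l` the position of `(a,b)` when the pairs are
listed by decreasing `s_a s_b`.

These products decrease in each index, so counting the pairs forced to come earlier bounds positions
from below. This bounds each column by one coefficient, the bounds adding up to `P`, and controls
the last row and column through `p`. A Schur test, sharpened at the last index
(`quadratic_form_le`), bounds the resulting quadratic form by `θ ∑ s_a²`; for `μ_{k²} > 0`, `θ` is
the value at which the sharpening balances (`exists_theta_weight`).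

The maximum is attained because Schmidt decompositions padded with zeros form a compact set, and
passing from vectors to `S_k` is convexity. -/

/-! ### Rearrangement for doubly substochastic couplings -/

/-- Summation by parts: an antitone nonnegative weight preserves nonnegativity of sums whose
partial sums are nonnegative. -/
theorem sum_antitone_mul_nonneg {z c : ℕ → ℝ} (hz : Antitone z) (hz0 : ∀ l, 0 ≤ z l) (N : ℕ)
    (hc : ∀ L ≤ N, 0 ≤ ∑ l ∈ Finset.range L, c l) :
    0 ≤ ∑ l ∈ Finset.range N, z l * c l := by
  suffices h : ∀ L ≤ N, z L * ∑ l ∈ Finset.range L, c l ≤ ∑ l ∈ Finset.range L, z l * c l from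
    (mul_nonneg (hz0 N) (hc N le_rfl)).trans (h N le_rfl)
  intro L
  induction L with
  | zero => simp
  | succ L ih =>
    intro hL
    have h1 := ih (by omega)
    have h2 := mul_le_mul_of_nonneg_right (hz (Nat.le_succ L)) (hc (L + 1) hL)
    rw [Finset.sum_range_succ] at h2 ⊢
    rw [Finset.sum_range_succ]
    linarith [mul_add (z L) (∑ l ∈ Finset.range L, c l) (c L)]

/-- Weights between `0` and `1` of total mass at most `L` pick at most the sum of the `L` largest
entries. -/
theorem sum_mul_weight_le {μ τ : ℕ → ℝ} {L M : ℕ} (hLM : L ≤ M)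
    (hμ0 : ∀ i ∈ Finset.Icc 1 M, 0 ≤ μ i)
    (hμ : ∀ i ∈ Finset.Icc 1 M, ∀ j ∈ Finset.Icc 1 M, i ≤ j → μ j ≤ μ i)
    (hτ0 : ∀ i ∈ Finset.Icc 1 M, 0 ≤ τ i) (hτ1 : ∀ i ∈ Finset.Icc 1 M, τ i ≤ 1)
    (hτ : ∑ i ∈ Finset.Icc 1 M, τ i ≤ L) :
    ∑ i ∈ Finset.Icc 1 M, μ i * τ i ≤ ∑ l ∈ Finset.range L, μ (l + 1) := by
  -- `L = 0` is separate because the threshold `μ L` used below is controlled only for indices from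
  -- `1` on.
  rcases Nat.eq_zero_or_pos L with rfl | hL
  · have h0 : ∀ i ∈ Finset.Icc 1 M, τ i = 0 :=
      (Finset.sum_eq_zero_iff_of_nonneg hτ0).1
        (le_antisymm (by simpa using hτ) (Finset.sum_nonneg hτ0))
    rw [Finset.sum_eq_zero fun i hi => by rw [h0 i hi, mul_zero]]
    simp
  have hLm : L ∈ Finset.Icc 1 M := Finset.mem_Icc.2 ⟨hL, hLM⟩
  have hind : ∀ f : ℕ → ℝ, ∑ l ∈ Finset.range L, f (l + 1) =
      ∑ i ∈ Finset.Icc 1 M, f i * (if i ≤ L then 1 else 0) := by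
    intro f
    have : Finset.Icc 1 L = (Finset.Icc 1 M).filter (· ≤ L) := by
      ext i; simp only [Finset.mem_Icc, Finset.mem_filter]; omega
    simp only [mul_ite, mul_one, mul_zero]
    rw [← Finset.sum_filter, ← this, Finset.range_eq_Ico, Finset.sum_Ico_add' f 0 L 1]
    rfl
  have hone := hind fun _ => 1
  simp only [Finset.sum_const, Finset.card_range, nsmul_eq_mul, mul_one, one_mul] at hone
  rw [hind]
  -- Measured from the threshold `μ L`, the two factors have opposite signs on either side of `L`.
  have hle : ∑ i ∈ Finset.Icc 1 M, (μ i - μ L) * (τ i - if i ≤ L then 1 else 0) ≤ 0 := by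
    refine Finset.sum_nonpos fun i hi => ?_
    split_ifs with h
    · exact mul_nonpos_of_nonneg_of_nonpos (sub_nonneg.2 (hμ i hi L hLm h))
        (sub_nonpos.2 (hτ1 i hi))
    · exact mul_nonpos_of_nonpos_of_nonneg (sub_nonpos.2 (hμ L hLm i hi (by omega)))
        (by simpa using hτ0 i hi)
  have hexp : ∑ i ∈ Finset.Icc 1 M, (μ i - μ L) * (τ i - if i ≤ L then 1 else 0) =
      (∑ i ∈ Finset.Icc 1 M, μ i * τ i) -
        (∑ i ∈ Finset.Icc 1 M, μ i * (if i ≤ L then 1 else 0)) -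
        μ L * ((∑ i ∈ Finset.Icc 1 M, τ i) - L) := by
    rw [hone, ← Finset.sum_sub_distrib, ← Finset.sum_sub_distrib, Finset.mul_sum,
      ← Finset.sum_sub_distrib]
    exact Finset.sum_congr rfl fun i _ => by ring
  nlinarith [mul_nonneg (hμ0 L hLm) (sub_nonneg.2 hτ)]

/-- The rearrangement inequality for a doubly substochastic coupling. -/
theorem sum_substochastic_le {N M : ℕ} (hNM : N ≤ M) {z μ : ℕ → ℝ} {T : ℕ → ℕ → ℝ}
    (hz : Antitone z) (hz0 : ∀ l, 0 ≤ z l) (hμ0 : ∀ i ∈ Finset.Icc 1 M, 0 ≤ μ i)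
    (hμ : ∀ i ∈ Finset.Icc 1 M, ∀ j ∈ Finset.Icc 1 M, i ≤ j → μ j ≤ μ i)
    (hT0 : ∀ l i, 0 ≤ T l i) (hrow : ∀ l, ∑ i ∈ Finset.Icc 1 M, T l i ≤ 1)
    (hcol : ∀ i ∈ Finset.Icc 1 M, ∑ l ∈ Finset.range N, T l i ≤ 1) :
    ∑ l ∈ Finset.range N, z l * ∑ i ∈ Finset.Icc 1 M, μ i * T l i ≤
      ∑ l ∈ Finset.range N, z l * μ (l + 1) := by
  rw [← sub_nonneg, ← Finset.sum_sub_distrib]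
  simp_rw [← mul_sub]
  -- Only the first `L` rows matter for the `L`-th partial sum; their column sums are weights in
  -- `[0, 1]` of total mass at most `L`.
  refine sum_antitone_mul_nonneg hz hz0 N fun L hL => ?_
  rw [Finset.sum_sub_distrib, sub_nonneg, Finset.sum_comm]
  simp_rw [← Finset.mul_sum]
  refine sum_mul_weight_le (hL.trans hNM) hμ0 hμ
    (fun i _ => Finset.sum_nonneg fun l _ => hT0 l i) (fun i hi => ?_) ?_
  · exact (Finset.sum_le_sum_of_subset_of_nonneg (Finset.range_mono hL)
      fun l _ _ => hT0 l i).trans (hcol i hi)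
  · rw [Finset.sum_comm]
    refine (Finset.sum_le_sum fun l _ => hrow l).trans ?_
    simp

/-! ### Positions of index pairs ordered by decreasing product -/

/-- An enumeration of the index pairs by decreasing product of weights, compatible with the
product order of the indices. -/
theorem exists_product_enumeration {k : ℕ} {s : Fin k → ℝ} (hs : Antitone s)
    (hs0 : ∀ a, 0 ≤ s a) :
    ∃ e : Fin (k * k) ≃ Fin k × Fin k,
      Antitone (fun l => s (e l).1 * s (e l).2) ∧
      ∀ a b c d : Fin k, a ≤ c → b ≤ d → (a, b) ≠ (c, d) →
        e.symm (a, b) < e.symm (c, d) ∧ e.symm (b, a) < e.symm (c, d) := by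
  -- Breaking ties by `a + b` makes the comparison strict even where products coincide, and the key
  -- is invariant under swapping the two indices.
  let key : Fin k × Fin k → ℝ ×ₗ ℕ := fun x => toLex (-(s x.1 * s x.2), (x.1 : ℕ) + x.2)
  let f : Fin (k * k) → ℝ ×ₗ ℕ := key ∘ finProdFinEquiv.symm
  let e : Fin (k * k) ≃ Fin k × Fin k := (Tuple.sort f).trans finProdFinEquiv.symm
  have he : Monotone (key ∘ e) := Tuple.monotone_sort f
  have hlt : ∀ x y, key x < key y → e.symm x < e.symm y := by
    intro x y h
    by_contra! hc
    have := he hc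
    simp only [Function.comp_apply, Equiv.apply_symm_apply] at this
    exact absurd h this.not_gt
  refine ⟨e, fun l l' h => ?_, fun a b c d hac hbd hne => ?_⟩
  · have := he h
    simp only [Function.comp_apply, key, Prod.Lex.toLex_le_toLex] at this
    rcases this with h | h
    · exact (neg_lt_neg_iff.1 h).le
    · exact (neg_injective h.1).ge
  · have hprod : s c * s d ≤ s a * s b := mul_le_mul (hs hac) (hs hbd) (hs0 d) (hs0 a)
    have hsum : (a : ℕ) + b < c + d := by
      rcases hac.lt_or_eq with h | rfl
      · exact Nat.add_lt_add_of_lt_of_le h hbd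
      · rcases hbd.lt_or_eq with h | rfl
        · exact Nat.add_lt_add_left h _
        · exact absurd rfl hne
    refine ⟨hlt _ _ ?_, hlt _ _ ?_⟩ <;> simp only [key, Prod.Lex.toLex_lt_toLex]
    · rcases hprod.lt_or_eq with h | h
      · exact Or.inl (neg_lt_neg h)
      · exact Or.inr ⟨by rw [h], hsum⟩
    · rcases hprod.lt_or_eq with h | h
      · exact Or.inl (by rw [mul_comm (s b)]; exact neg_lt_neg h)
      · exact Or.inr ⟨by rw [h, mul_comm], by omega⟩

/-- A position preceded by all members of `S` is at least the cardinality of `S`. -/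
theorem card_le_of_forall_lt {α : Type*} {N : ℕ} (e : Fin N ≃ α) (S : Finset α) (q : ℕ)
    (h : ∀ y ∈ S, (e.symm y : ℕ) < q) : S.card ≤ q := by
  rw [← Finset.card_range q]
  exact Finset.card_le_card_of_injOn (fun y => (e.symm y : ℕ))
    (fun y hy => by simpa using h y hy)
    fun x _ y _ hxy => e.symm.injective (Fin.ext hxy)

/-- For `b ≥ 1` the pairs `(c, 0)` and `(0, c)` with `c < b` number `2b - 1`, the two arms sharing
only `(0, 0)`, and all precede both `(a, b)` and `(b, a)`. The `+ 1` turns a zero-based position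
into an index of `μ`. -/
theorem two_mul_le_position {K : ℕ} (e : Fin ((K + 1) * (K + 1)) ≃ Fin (K + 1) × Fin (K + 1))
    (he : ∀ a b c d : Fin (K + 1), a ≤ c → b ≤ d → (a, b) ≠ (c, d) →
        e.symm (a, b) < e.symm (c, d) ∧ e.symm (b, a) < e.symm (c, d)) (a b : Fin (K + 1)) :
    2 * (b : ℕ) ≤ (e.symm (a, b) : ℕ) + 1 ∧ 2 * (b : ℕ) ≤ (e.symm (b, a) : ℕ) + 1 := by
  have hcard : ((Finset.Iio b ×ˢ {(0 : Fin (K + 1))}) ∪ ({(0 : Fin (K + 1))} ×ˢ Finset.Iio b) :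
      Finset (Fin (K + 1) × Fin (K + 1))).card + 1 ≥ 2 * (b : ℕ) := by
    have h := Finset.card_union_add_card_inter (Finset.Iio b ×ˢ {(0 : Fin (K + 1))})
      ({(0 : Fin (K + 1))} ×ˢ Finset.Iio b)
    have h2 : ((Finset.Iio b ×ˢ {(0 : Fin (K + 1))}) ∩
        ({(0 : Fin (K + 1))} ×ˢ Finset.Iio b)).card ≤ 1 := by
      refine Finset.card_le_one.2 fun x hx y hy => ?_
      simp only [Finset.mem_inter, Finset.mem_product, Finset.mem_singleton] at hx hy
      exact Prod.ext (hx.2.1.trans hy.2.1.symm) (hx.1.2.trans hy.1.2.symm)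
    simp only [Finset.card_product, Fin.card_Iio, Finset.card_singleton] at h
    omega
  have key : ∀ x : Fin (K + 1) × Fin (K + 1), (x = (a, b) ∨ x = (b, a)) →
      2 * (b : ℕ) ≤ (e.symm x : ℕ) + 1 := by
    intro x hx
    refine hcard.le.trans (Nat.add_le_add_right (card_le_of_forall_lt e _ (e.symm x) ?_) 1)
    · rintro ⟨c, d⟩ hy
      simp only [Finset.mem_union, Finset.mem_product, Finset.mem_singleton, Finset.mem_Iio] at hy
      rcases hy with ⟨hc, rfl⟩ | ⟨rfl, hd⟩
      · have h1 := he 0 c a b (Fin.zero_le a) hc.le (by simp [Prod.ext_iff, hc.ne])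
        have h2 := he c 0 b a hc.le (Fin.zero_le a) (by simp [Prod.ext_iff, hc.ne])
        rcases hx with rfl | rfl
        exacts [h1.2, h2.1]
      · have h1 := he 0 d a b (Fin.zero_le a) hd.le (by simp [Prod.ext_iff, hd.ne])
        have h2 := he d 0 b a hd.le (Fin.zero_le a) (by simp [Prod.ext_iff, hd.ne])
        rcases hx with rfl | rfl
        exacts [h1.1, h2.2]
  exact ⟨key _ (Or.inl rfl), key _ (Or.inr rfl)⟩

/-- A pair with first index at most `j` comes no later than `(j, K)`, one with second index at most
`j` no later than `(K, j)`. So the later of these two positions has the whole L-shaped complement of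
a square of side `K - j` at or before it. -/
theorem le_position_last {K : ℕ} (e : Fin ((K + 1) * (K + 1)) ≃ Fin (K + 1) × Fin (K + 1))
    (he : ∀ a b c d : Fin (K + 1), a ≤ c → b ≤ d → (a, b) ≠ (c, d) →
        e.symm (a, b) < e.symm (c, d) ∧ e.symm (b, a) < e.symm (c, d)) (j : Fin K) :
    (K + 1) ^ 2 - (K + 1 - (j + 1)) ^ 2 ≤
      max (e.symm (j.castSucc, Fin.last K) : ℕ) (e.symm (Fin.last K, j.castSucc)) + 1 := by
  set q := max (e.symm (j.castSucc, Fin.last K) : ℕ) (e.symm (Fin.last K, j.castSucc))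
  have hcard : ((Finset.Ioi j.castSucc ×ˢ Finset.Ioi j.castSucc)ᶜ :
      Finset (Fin (K + 1) × Fin (K + 1))).card = (K + 1) ^ 2 - (K + 1 - (j + 1)) ^ 2 := by
    rw [Finset.card_compl, Finset.card_product, Fin.card_Ioi, Fintype.card_prod, Fintype.card_fin,
      sq, sq, Fin.val_castSucc]
    congr 2 <;> omega
  rw [← hcard]
  refine card_le_of_forall_lt e _ (q + 1) ?_
  rintro ⟨c, d⟩ hy
  rw [Nat.lt_succ_iff]
  simp only [Finset.mem_compl, Finset.mem_product, Finset.mem_Ioi, not_and_or, not_lt] at hy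
  rcases hy with h | h
  · refine le_trans ?_ (le_max_left _ _)
    by_cases hne : (c, d) = (j.castSucc, Fin.last K)
    · rw [hne]
    · exact (he c d _ _ h (Fin.le_last d) hne).1.le
  · refine le_trans ?_ (le_max_right _ _)
    by_cases hne : (c, d) = (Fin.last K, j.castSucc)
    · rw [hne]
    · exact (he c d _ _ (Fin.le_last c) h hne).1.le

theorem position_last_last {K : ℕ} (e : Fin ((K + 1) * (K + 1)) ≃ Fin (K + 1) × Fin (K + 1))
    (he : ∀ a b c d : Fin (K + 1), a ≤ c → b ≤ d → (a, b) ≠ (c, d) →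
        e.symm (a, b) < e.symm (c, d) ∧ e.symm (b, a) < e.symm (c, d)) :
    (K + 1) ^ 2 ≤ (e.symm (Fin.last K, Fin.last K) : ℕ) + 1 := by
  have hcard : (Finset.univ : Finset (Fin (K + 1) × Fin (K + 1))).card = (K + 1) ^ 2 := by
    simp [sq]
  rw [← hcard]
  refine card_le_of_forall_lt e _ _ fun y _ => Nat.lt_succ_iff.2 ?_
  by_cases hne : y = (Fin.last K, Fin.last K)
  · rw [hne]
  · exact (he y.1 y.2 _ _ (Fin.le_last _) (Fin.le_last _) hne).1.le

/-! ### The sums `P` and `p`, and the equation for `θ` -/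

theorem firstRowSum_succ (K : ℕ) (μ : ℕ → ℝ) :
    firstRowSum (K + 1) μ = ∑ b : Fin (K + 1), μ (max 1 (2 * (b : ℕ))) := by
  rw [Fin.sum_univ_succ, firstRowSum, Nat.add_sub_cancel]
  congr 1
  simp only [Fin.val_succ]
  rw [Fin.sum_univ_eq_sum_range (fun b => μ (max 1 (2 * (b + 1)))) K, Finset.range_eq_Ico,
    Finset.sum_Ico_add' (fun b => μ (max 1 (2 * b))) 0 K 1]
  exact Finset.sum_congr rfl fun b hb => by
    have := (Finset.mem_Icc.1 hb).1
    rw [max_eq_right (by omega)]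

theorem lastRowSum_succ (K : ℕ) (μ : ℕ → ℝ) :
    lastRowSum (K + 1) μ =
      ∑ j : Fin K, μ ((K + 1) ^ 2 - (K + 1 - (j + 1)) ^ 2) + μ ((K + 1) ^ 2) := by
  have h : lastRowSum (K + 1) μ =
      ∑ j ∈ Finset.range (K + 1), μ ((K + 1) ^ 2 - (K + 1 - (j + 1)) ^ 2) := by
    rw [Finset.range_eq_Ico,
      Finset.sum_Ico_add' (fun j => μ ((K + 1) ^ 2 - (K + 1 - j) ^ 2)) 0 (K + 1) 1]
    rfl
  rw [h, Finset.sum_range_succ, Fin.sum_univ_eq_sum_range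
    (fun j => μ ((K + 1) ^ 2 - (K + 1 - (j + 1)) ^ 2)) K]
  simp

/-- Index comparison behind `p ≤ P`, term by term: each index in `p` is at least the corresponding
one in `P`. -/
theorem le_sq_sub_sq {K j : ℕ} (hj : j < K) :
    max 1 (2 * j) ≤ (K + 1) ^ 2 - (K + 1 - (j + 1)) ^ 2 := by
  obtain ⟨r, rfl⟩ := Nat.exists_eq_add_of_lt hj
  have h : j + r + 1 + 1 - (j + 1) = r + 1 := by omega
  rw [h]
  apply Nat.le_sub_of_add_le
  rcases max_cases 1 (2 * j) with ⟨h, _⟩ | ⟨h, _⟩ <;> rw [h] <;> nlinarith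

theorem lastRowSum_le_firstRowSum {K : ℕ} {μ : ℕ → ℝ}
    (hμ : ∀ i ∈ Finset.Icc 1 ((K + 1) ^ 2), ∀ j ∈ Finset.Icc 1 ((K + 1) ^ 2), i ≤ j → μ j ≤ μ i) :
    lastRowSum (K + 1) μ ≤ firstRowSum (K + 1) μ := by
  rw [firstRowSum_succ, lastRowSum_succ, Fin.sum_univ_castSucc]
  have hmem : ∀ b ≤ K, max 1 (2 * b) ∈ Finset.Icc 1 ((K + 1) ^ 2) := fun b hb =>
    Finset.mem_Icc.2 ⟨le_max_left _ _, max_le (by nlinarith) (by nlinarith)⟩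
  refine add_le_add (Finset.sum_le_sum fun j _ => ?_) ?_
  · exact hμ _ (hmem _ j.2.le) _ (Finset.mem_Icc.2
      ⟨(le_max_left _ _).trans (le_sq_sub_sq j.2), Nat.sub_le _ _⟩) (le_sq_sub_sq j.2)
  · exact hμ _ (hmem K le_rfl) _ (Finset.mem_Icc.2 ⟨Nat.one_le_pow _ _ K.succ_pos, le_rfl⟩)
      (Finset.mem_Icc.1 (hmem K le_rfl)).2

/-- The weight `w` with `θ = P - κ + κ w` satisfies `0 < w ≤ 1` and `p - κ ≤ w (θ - κ)`. -/
theorem exists_theta_weight {K : ℕ} (hK : 1 ≤ K) {μ : ℕ → ℝ}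
    (hμ0 : ∀ i ∈ Finset.Icc 1 ((K + 1) ^ 2), 0 ≤ μ i)
    (hμ : ∀ i ∈ Finset.Icc 1 ((K + 1) ^ 2), ∀ j ∈ Finset.Icc 1 ((K + 1) ^ 2), i ≤ j → μ j ≤ μ i) :
    ∃ w : ℝ, 0 < w ∧ w ≤ 1 ∧
      thetaCoeff (K + 1) μ =
        firstRowSum (K + 1) μ - μ ((K + 1) ^ 2) + μ ((K + 1) ^ 2) * w ∧
      lastRowSum (K + 1) μ - μ ((K + 1) ^ 2) ≤ w * (thetaCoeff (K + 1) μ - μ ((K + 1) ^ 2)) := by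
  have hpP := lastRowSum_le_firstRowSum hμ
  have hlast : μ ((K + 1) ^ 2) + K * μ ((K + 1) ^ 2) ≤ lastRowSum (K + 1) μ := by
    rw [lastRowSum_succ, add_comm]
    gcongr
    calc (K : ℝ) * μ ((K + 1) ^ 2) = ∑ _j : Fin K, μ ((K + 1) ^ 2) := by simp
      _ ≤ _ := Finset.sum_le_sum fun j _ => hμ _ (Finset.mem_Icc.2
          ⟨(le_max_left _ _).trans (le_sq_sub_sq j.2), Nat.sub_le _ _⟩) _
          (Finset.mem_Icc.2 ⟨Nat.one_le_pow _ _ K.succ_pos, le_rfl⟩) (Nat.sub_le _ _)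
  have hκ0 : 0 ≤ μ ((K + 1) ^ 2) := hμ0 _ (Finset.mem_Icc.2 ⟨Nat.one_le_pow _ _ K.succ_pos, le_rfl⟩)
  rw [thetaCoeff]
  set κ := μ ((K + 1) ^ 2)
  set P := firstRowSum (K + 1) μ
  set p := lastRowSum (K + 1) μ
  -- If `κ = 0` the fraction in `θ` is multiplied by zero and may be `0 / 0`; then `θ = P` and `w =
  -- 1` works by `p ≤ P`.
  rcases hκ0.eq_or_lt with h0 | hκ
  · exact ⟨1, one_pos, le_rfl, by simp [← h0], by simp only [← h0]; linarith⟩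
  have hK' : (1 : ℝ) ≤ K := by exact_mod_cast hK
  have hpκ : κ ≤ p - κ := by nlinarith
  have hdisc : P ^ 2 - 4 * κ * (P - p) = (P - 2 * κ) ^ 2 + 4 * κ * (p - κ) := by ring
  have hdisc0 : 0 ≤ P ^ 2 - 4 * κ * (P - p) := by rw [hdisc]; nlinarith [sq_nonneg (P - 2 * κ)]
  set R := √(P ^ 2 - 4 * κ * (P - p))
  have hR2 : R ^ 2 = (P - 2 * κ) ^ 2 + 4 * κ * (p - κ) := by rw [← hdisc]; exact Real.sq_sqrt hdisc0
  have hRpos : 0 < R := Real.sqrt_pos.2 (by rw [hdisc]; nlinarith [sq_nonneg (P - 2 * κ)])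
  have hRle : 2 * p - P ≤ R := Real.le_sqrt_of_sq_le (by nlinarith)
  have hden : 0 < P - 2 * κ + R := by linarith
  -- This is the positive root of `κ w² + (P - 2κ) w = p - κ`, with the square root moved to the
  -- denominator; hence `p - κ = w (θ - κ)` exactly.
  refine ⟨2 * (p - κ) / (P - 2 * κ + R), div_pos (by linarith) hden,
    (div_le_one hden).2 (by linarith), rfl, le_of_eq ?_⟩
  have hD : (P - 2 * κ + R) ^ 2 = 2 * (P - 2 * κ) * (P - 2 * κ + R) + 4 * κ * (p - κ) := by
    linear_combination hR2
  generalize P - 2 * κ + R = D at hden hD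
  have h : 2 * (p - κ) / D * (P - κ + κ * (2 * (p - κ) / D) - κ) =
      (p - κ) * ((2 * (P - 2 * κ) * D + 4 * κ * (p - κ)) / D ^ 2) := by
    field_simp
    ring
  rw [h, ← hD, div_self (by positivity), mul_one]

/-! ### The quadratic form and the combinatorial bound -/

/-- A quadratic form bound of Brauer type: entries below `e b` in column `b`, and a last row and
column whose smaller halves add up to at most `p - κ`. -/
theorem quadratic_form_le {K : ℕ} {s : Fin (K + 1) → ℝ} (hs : Antitone s) (hs0 : ∀ a, 0 ≤ s a)
    {F : Fin (K + 1) → Fin (K + 1) → ℝ} {e : Fin (K + 1) → ℝ} {κ p w θ : ℝ}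
    (hF : ∀ a b, F a b ≤ e b) (hF' : ∀ a b, F b a ≤ e b)
    (hκ : ∀ a b, κ ≤ F a b) (hκ0 : 0 ≤ κ) (hcorner : F (Fin.last K) (Fin.last K) ≤ κ)
    (hp : ∑ j : Fin K, min (F j.castSucc (Fin.last K)) (F (Fin.last K) j.castSucc) ≤ p - κ)
    (hw0 : 0 < w) (hw1 : w ≤ 1) (hθ : θ = ∑ b, e b - κ + κ * w) (hpθ : p - κ ≤ w * (θ - κ)) :
    ∑ a, ∑ b, s a * s b * F a b ≤ θ * ∑ a, s a ^ 2 := by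
  set t := s (Fin.last K)
  set E := e (Fin.last K)
  let d : Fin K → ℝ := fun j => min (F j.castSucc (Fin.last K)) (F (Fin.last K) j.castSucc)
  have hd : ∀ j, F j.castSucc (Fin.last K) + F (Fin.last K) j.castSucc =
      max (F j.castSucc (Fin.last K)) (F (Fin.last K) j.castSucc) + d j := fun j =>
    (max_add_min _ _).symm
  -- Schur test off the last index: `s_a s_b ≤ (s_a² + s_b²) / 2`, with each square weighted by the
  -- bound of the other index.
  have hblock : ∑ a : Fin K, ∑ b : Fin K, s a.castSucc * s b.castSucc * F a.castSucc b.castSucc ≤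
      ∑ a : Fin K, (∑ b, e b - E) * s a.castSucc ^ 2 := by
    have hsum : ∑ b, e b - E = ∑ b : Fin K, e b.castSucc := by
      rw [Fin.sum_univ_castSucc]; simp [E]
    calc ∑ a : Fin K, ∑ b : Fin K, s a.castSucc * s b.castSucc * F a.castSucc b.castSucc
        ≤ ∑ a : Fin K, ∑ b : Fin K, (s a.castSucc ^ 2 * e b.castSucc / 2 +
            s b.castSucc ^ 2 * e a.castSucc / 2) := by
          refine Finset.sum_le_sum fun a _ => Finset.sum_le_sum fun b _ => ?_
          have h0 : 0 ≤ F a.castSucc b.castSucc := hκ0.trans (hκ _ _)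
          have h1 := mul_le_mul_of_nonneg_left (hF a.castSucc b.castSucc)
            (sq_nonneg (s a.castSucc))
          have h2 := mul_le_mul_of_nonneg_left (hF' b.castSucc a.castSucc)
            (sq_nonneg (s b.castSucc))
          nlinarith [mul_nonneg h0 (sq_nonneg (s a.castSucc - s b.castSucc))]
      _ = ∑ a : Fin K, (∑ b, e b - E) * s a.castSucc ^ 2 := by
          simp_rw [Finset.sum_add_distrib]
          rw [Finset.sum_comm (f := fun a b : Fin K => s b.castSucc ^ 2 * e a.castSucc / 2),
            ← Finset.sum_add_distrib, hsum]
          refine Finset.sum_congr rfl fun a _ => ?_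
          rw [← Finset.sum_add_distrib, Finset.sum_mul]
          exact Finset.sum_congr rfl fun b _ => by ring
  -- The larger cross entry is at most `E`, and `t ≤ x` gives `E t x ≤ E x² - d x (x - t)`. What
  -- remains is `2 d t x - d x²`; splitting `2 t x ≤ w x² + t² / w` leaves `-d (1 - w) x²`, and `κ ≤
  -- d` turns the coefficient of `x²` into `θ`.
  have hterm : ∀ a : Fin K, (∑ b, e b - E) * s a.castSucc ^ 2 +
      t * s a.castSucc * (F a.castSucc (Fin.last K) + F (Fin.last K) a.castSucc) ≤
      θ * s a.castSucc ^ 2 + d a * (t ^ 2 / w) := by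
    intro a
    rw [hd a]
    set x := s a.castSucc
    have ht0 : 0 ≤ t := hs0 _
    have hx0 : 0 ≤ x := hs0 _
    have htx : t ≤ x := hs (Fin.le_last _)
    have hc : max (F a.castSucc (Fin.last K)) (F (Fin.last K) a.castSucc) ≤ E :=
      max_le (hF _ _) (hF' _ _)
    have hdE : d a ≤ E := (min_le_left _ _).trans (hF _ _)
    have hdκ : κ ≤ d a := le_min (hκ _ _) (hκ _ _)
    have h1 := mul_le_mul_of_nonneg_left hc (mul_nonneg ht0 hx0)
    have h2 : 0 ≤ (E - d a) * (x * (x - t)) :=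
      mul_nonneg (sub_nonneg.2 hdE) (mul_nonneg hx0 (sub_nonneg.2 htx))
    have h3 : 0 ≤ (d a - κ) * (1 - w) * x ^ 2 :=
      mul_nonneg (mul_nonneg (sub_nonneg.2 hdκ) (sub_nonneg.2 hw1)) (sq_nonneg x)
    have h4 : 0 ≤ d a * ((w * x - t) ^ 2 / w) :=
      mul_nonneg (hκ0.trans hdκ) (div_nonneg (sq_nonneg _) hw0.le)
    have h5 : (w * x - t) ^ 2 / w = w * x ^ 2 - 2 * t * x + t ^ 2 / w := by
      field_simp
      ring
    rw [h5] at h4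
    rw [hθ]
    linarith
  have hsplit : ∑ a, ∑ b, s a * s b * F a b =
      ∑ a : Fin K, ∑ b : Fin K, s a.castSucc * s b.castSucc * F a.castSucc b.castSucc +
      ∑ a : Fin K, t * s a.castSucc * (F a.castSucc (Fin.last K) + F (Fin.last K) a.castSucc) +
      t ^ 2 * F (Fin.last K) (Fin.last K) := by
    simp_rw [Fin.sum_univ_castSucc]
    rw [Finset.sum_add_distrib]
    simp_rw [mul_add]
    rw [Finset.sum_add_distrib]
    have h1 : ∀ a : Fin K, s a.castSucc * s (Fin.last K) * F a.castSucc (Fin.last K) =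
      t * s a.castSucc * F a.castSucc (Fin.last K) := fun a => by ring
    simp_rw [h1]
    ring
  -- The `t²` terms accumulated from all cross terms fit into `θ - κ`, leaving exactly `κ` for the
  -- corner entry.
  have hlast : (∑ j, d j) * (t ^ 2 / w) ≤ (θ - κ) * t ^ 2 := by
    calc (∑ j, d j) * (t ^ 2 / w) ≤ w * (θ - κ) * (t ^ 2 / w) := by
          gcongr
          exact hp.trans hpθ
      _ = (θ - κ) * t ^ 2 := by field_simp
  have hall := Finset.sum_le_sum fun a (_ : a ∈ Finset.univ) => hterm a
  rw [Finset.sum_add_distrib, Finset.sum_add_distrib, ← Finset.sum_mul, ← Finset.mul_sum,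
    ← Finset.mul_sum] at hall
  rw [← Finset.mul_sum] at hblock
  rw [hsplit, Fin.sum_univ_castSucc]
  have hcorner' := mul_le_mul_of_nonneg_left hcorner (sq_nonneg t)
  linarith [mul_add θ (∑ a : Fin K, s a.castSucc ^ 2) (t ^ 2)]

/-- The combinatorial form of the bound: a doubly substochastic coupling of the products
`s a * s b` with `μ` has total at most `θ ∑ s a ^ 2`. -/
theorem coupling_le_theta {k M : ℕ} (hk : 2 ≤ k) (hkM : k ^ 2 ≤ M) {s : Fin k → ℝ}
    (hs : Antitone s) (hs0 : ∀ a, 0 ≤ s a) {μ : ℕ → ℝ} (hμ0 : ∀ i ∈ Finset.Icc 1 M, 0 ≤ μ i)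
    (hμ : ∀ i ∈ Finset.Icc 1 M, ∀ j ∈ Finset.Icc 1 M, i ≤ j → μ j ≤ μ i)
    {T : Fin k × Fin k → ℕ → ℝ} (hT0 : ∀ x i, 0 ≤ T x i)
    (hrow : ∀ x, ∑ i ∈ Finset.Icc 1 M, T x i ≤ 1)
    (hcol : ∀ i ∈ Finset.Icc 1 M, ∑ x, T x i ≤ 1) :
    ∑ x : Fin k × Fin k, s x.1 * s x.2 * ∑ i ∈ Finset.Icc 1 M, μ i * T x i ≤
      thetaCoeff k μ * ∑ a, s a ^ 2 := by
  obtain ⟨K, rfl⟩ : ∃ K, k = K + 1 := ⟨k - 1, by omega⟩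
  obtain ⟨e, hanti, he⟩ := exists_product_enumeration hs hs0
  have hNM : (K + 1) * (K + 1) ≤ M := by rw [← sq]; exact hkM
  have hsub : Finset.Icc 1 ((K + 1) ^ 2) ⊆ Finset.Icc 1 M := Finset.Icc_subset_Icc_right hkM
  have hμ0' := fun i hi => hμ0 i (hsub hi)
  have hμ' := fun i hi j hj => hμ i (hsub hi) j (hsub hj)
  obtain ⟨w, hw0, hw1, hθ, hpθ⟩ := exists_theta_weight (by omega : 1 ≤ K) hμ0' hμ'
  have hpos : ∀ x, (e.symm x : ℕ) + 1 ∈ Finset.Icc 1 ((K + 1) ^ 2) := fun x =>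
    Finset.mem_Icc.2 ⟨by omega, by have := (e.symm x).2; rw [sq]; omega⟩
  have hrank : ∑ x : Fin (K + 1) × Fin (K + 1), s x.1 * s x.2 *
      ∑ i ∈ Finset.Icc 1 M, μ i * T x i ≤
      ∑ x : Fin (K + 1) × Fin (K + 1), s x.1 * s x.2 * μ ((e.symm x : ℕ) + 1) := by
    rw [← e.sum_comp, ← e.sum_comp (fun x => s x.1 * s x.2 * μ ((e.symm x : ℕ) + 1))]
    -- Extension by zero past the last position keeps `z` antitone, since the products are
    -- nonnegative.
    let z : ℕ → ℝ := fun l => if h : l < (K + 1) * (K + 1) then s (e ⟨l, h⟩).1 * s (e ⟨l, h⟩).2 else 0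
    let T' : ℕ → ℕ → ℝ := fun l i => if h : l < (K + 1) * (K + 1) then T (e ⟨l, h⟩) i else 0
    have hz0 : ∀ l, 0 ≤ z l := fun l => by
      simp only [z]; split_ifs
      exacts [mul_nonneg (hs0 _) (hs0 _), le_rfl]
    have hz : Antitone z := by
      intro l l' hl
      by_cases h' : l' < (K + 1) * (K + 1)
      · have h : l < (K + 1) * (K + 1) := hl.trans_lt h'
        simp only [z, h, h', dif_pos]
        exact hanti (show (⟨l, h⟩ : Fin ((K + 1) * (K + 1))) ≤ ⟨l', h'⟩ from hl)
      · have : z l' = 0 := dif_neg h'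
        rw [this]; exact hz0 l
    have key := sum_substochastic_le hNM hz hz0 hμ0 hμ (T := T') (fun l i => by
        simp only [T']; split_ifs
        exacts [hT0 _ _, le_rfl]) (fun l => by
        simp only [T']; split_ifs
        exacts [hrow _, by simp]) (fun i hi => by
        rw [Finset.sum_range]
        simp only [T', Fin.is_lt, dif_pos]
        rw [e.sum_comp (fun x => T x i)]
        exact hcol i hi)
    rw [Finset.sum_range, Finset.sum_range] at key
    simpa only [z, T', Fin.is_lt, dif_pos, Equiv.symm_apply_apply] using key
  refine hrank.trans ?_
  rw [Fintype.sum_prod_type]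
  have hmem : ∀ b : Fin (K + 1), max 1 (2 * (b : ℕ)) ∈ Finset.Icc 1 ((K + 1) ^ 2) := fun b =>
    Finset.mem_Icc.2 ⟨le_max_left _ _, max_le (by nlinarith) (by nlinarith [b.2])⟩
  have hlast : (K + 1) ^ 2 ∈ Finset.Icc 1 ((K + 1) ^ 2) := Finset.mem_Icc.2 ⟨Nat.one_le_pow _ _ K.succ_pos, le_rfl⟩
  refine quadratic_form_le hs hs0 (F := fun a b => μ ((e.symm (a, b) : ℕ) + 1))
    (e := fun b => μ (max 1 (2 * (b : ℕ)))) (κ := μ ((K + 1) ^ 2))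
    (p := lastRowSum (K + 1) μ) (w := w) ?_ ?_ ?_ (hμ0' _ hlast) ?_ ?_ hw0 hw1 ?_ hpθ
  · exact fun a b => hμ' _ (hmem b) _ (hpos _) (max_le (by omega) (two_mul_le_position e he a b).1)
  · exact fun a b => hμ' _ (hmem b) _ (hpos _) (max_le (by omega) (two_mul_le_position e he a b).2)
  · exact fun a b => hμ' _ (hpos _) _ hlast (Finset.mem_Icc.1 (hpos _)).2
  · exact hμ' _ hlast _ (hpos _) (position_last_last e he)
  · rw [lastRowSum_succ, add_sub_cancel_right]
    refine Finset.sum_le_sum fun j _ => ?_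
    have hj := le_position_last e he j
    have hjm : (K + 1) ^ 2 - (K + 1 - ((j : ℕ) + 1)) ^ 2 ∈ Finset.Icc 1 ((K + 1) ^ 2) :=
      Finset.mem_Icc.2 ⟨(le_max_left _ _).trans (le_sq_sub_sq j.2), Nat.sub_le _ _⟩
    rcases le_total (e.symm (j.castSucc, Fin.last K) : ℕ) (e.symm (Fin.last K, j.castSucc))
      with h | h
    · rw [max_eq_right h] at hj
      exact (min_le_right _ _).trans (hμ' _ hjm _ (hpos _) hj)
    · rw [max_eq_left h] at hj
      exact (min_le_left _ _).trans (hμ' _ hjm _ (hpos _) hj)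
  · rw [hθ, firstRowSum_succ]

/-! ### Bessel's inequality and matrix elements in Hilbert-Schmidt space -/

/-- Bessel's inequality for an orthogonal family of vectors of norm at most one. -/
theorem sum_norm_inner_sq_le {E ι : Type*} [NormedAddCommGroup E] [InnerProductSpace ℂ E]
    (S : Finset ι) (w : ι → E) (hw : ∀ x ∈ S, ∀ y ∈ S, x ≠ y → inner ℂ (w x) (w y) = 0)
    (hw1 : ∀ x ∈ S, ‖w x‖ ≤ 1) (v : E) : ∑ x ∈ S, ‖inner ℂ (w x) v‖ ^ 2 ≤ ‖v‖ ^ 2 := by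
  classical
  set y := ∑ x ∈ S, inner ℂ (w x) v • w x with hy
  have hvy : inner ℂ y v = ((∑ x ∈ S, ‖inner ℂ (w x) v‖ ^ 2 : ℝ) : ℂ) := by
    rw [hy, sum_inner]
    push_cast
    refine Finset.sum_congr rfl fun x _ => ?_
    rw [inner_smul_left, ← Complex.normSq_eq_conj_mul_self, Complex.normSq_eq_norm_sq]
    push_cast
    rfl
  have hyy : ‖y‖ ^ 2 = ∑ x ∈ S, ‖inner ℂ (w x) v‖ ^ 2 * ‖w x‖ ^ 2 := by
    have h : inner ℂ y y = ((∑ x ∈ S, ‖inner ℂ (w x) v‖ ^ 2 * ‖w x‖ ^ 2 : ℝ) : ℂ) := by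
      nth_rewrite 1 [hy]
      rw [sum_inner]
      push_cast
      refine Finset.sum_congr rfl fun x hx => ?_
      rw [hy, inner_sum, Finset.sum_eq_single_of_mem x hx fun z hz hzx => by
        rw [inner_smul_left, inner_smul_right, hw x hx z hz hzx.symm, mul_zero, mul_zero]]
      rw [inner_smul_left, inner_smul_right, inner_self_eq_norm_sq_to_K, ← mul_assoc,
        ← Complex.normSq_eq_conj_mul_self, Complex.normSq_eq_norm_sq]
      push_cast
      rfl
    rw [inner_self_eq_norm_sq_to_K] at h
    exact Complex.ofReal_injective (by push_cast; simpa using h)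
  have hle : ‖y‖ ^ 2 ≤ ∑ x ∈ S, ‖inner ℂ (w x) v‖ ^ 2 := by
    rw [hyy]
    exact Finset.sum_le_sum fun x hx =>
      mul_le_of_le_one_right (sq_nonneg _) (pow_le_one₀ (norm_nonneg _) (hw1 x hx))
  have hsub := @norm_sub_sq ℂ E _ _ _ y v
  have hre : RCLike.re (inner ℂ y v) = ∑ x ∈ S, ‖inner ℂ (w x) v‖ ^ 2 := by
    rw [hvy]; exact Complex.ofReal_re _
  -- Without normalization `‖y‖²` is only bounded by the sum in question, which is still enough in
  -- `0 ≤ ‖y - v‖²`.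
  rw [hre] at hsub
  linarith [sq_nonneg ‖y - v‖]

/-- A matrix as a vector of the Hilbert-Schmidt space. -/
noncomputable def hsVec {d : ℕ} (A : Matrix (Fin d) (Fin d) ℂ) :
    EuclideanSpace ℂ (Fin d × Fin d) :=
  WithLp.toLp 2 fun x => A x.1 x.2

theorem inner_hsVec {d : ℕ} (A B : Matrix (Fin d) (Fin d) ℂ) :
    inner ℂ (hsVec A) (hsVec B) = hsInner A B := by
  rw [EuclideanSpace.inner_eq_star_dotProduct, hsInner, Matrix.trace, dotProduct,
    Fintype.sum_prod_type, Finset.sum_comm]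
  refine Finset.sum_congr rfl fun p _ => ?_
  simp [hsVec, Matrix.mul_apply, mul_comm]

/-- Matrix elements of `A` are Hilbert-Schmidt coefficients against `|x⟩⟨y|`, so Bessel's inequality
applies to them. -/
theorem inner_hsVec_vecMulVec {d : ℕ} (x y : Fin d → ℂ) (A : Matrix (Fin d) (Fin d) ℂ) :
    inner ℂ (hsVec (Matrix.vecMulVec x (star y))) (hsVec A) = star x ⬝ᵥ A *ᵥ y := by
  rw [inner_hsVec, hsInner, Matrix.conjTranspose_vecMulVec, star_star, Matrix.trace_mul_comm,
    Matrix.mul_vecMulVec, Matrix.trace_vecMulVec, dotProduct_comm]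

theorem inner_hsVec_vecMulVec_vecMulVec {d : ℕ} (x y x' y' : Fin d → ℂ) :
    inner ℂ (hsVec (Matrix.vecMulVec x (star y))) (hsVec (Matrix.vecMulVec x' (star y'))) =
      (star x ⬝ᵥ x') * (star y' ⬝ᵥ y) := by
  rw [inner_hsVec_vecMulVec, Matrix.vecMulVec_mulVec, dotProduct_smul]
  simp

theorem star_dotProduct_self {ι : Type*} [Fintype ι] (x : ι → ℂ) :
    star x ⬝ᵥ x = ((∑ j, ‖x j‖ ^ 2 : ℝ) : ℂ) := by
  push_cast
  refine Finset.sum_congr rfl fun j _ => ?_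
  rw [Pi.star_apply, Complex.star_def, Complex.conj_mul']

theorem star_dotProduct_self_re {ι : Type*} [Fintype ι] (x : ι → ℂ) :
    (star x ⬝ᵥ x).re = ∑ j, ‖x j‖ ^ 2 := by
  rw [star_dotProduct_self, Complex.ofReal_re]

theorem norm_hsVec_vecMulVec_le {d : ℕ} {x y : Fin d → ℂ} (hx : (star x ⬝ᵥ x).re ≤ 1)
    (hy : (star y ⬝ᵥ y).re ≤ 1) : ‖hsVec (Matrix.vecMulVec x (star y))‖ ≤ 1 := by
  rw [star_dotProduct_self_re] at hx hy
  rw [← sq_le_one_iff₀ (norm_nonneg _), ← @inner_self_eq_norm_sq ℂ,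
    inner_hsVec_vecMulVec_vecMulVec, star_dotProduct_self, star_dotProduct_self,
    ← Complex.ofReal_mul]
  exact mul_le_one₀ hx (Finset.sum_nonneg fun j _ => sq_nonneg _) hy

section Bessel

variable {d k : ℕ} {u : Fin k → Fin d → ℂ} {I : Finset ℕ} {A : ℕ → Matrix (Fin d) (Fin d) ℂ}

/-- Bessel for the orthonormal `A i`, tested on the single operator `|u_a⟩⟨u_b|` of norm at most
one. -/
theorem sum_norm_sq_matrixElement_le_left (hu1 : ∀ a, (star (u a) ⬝ᵥ u a).re ≤ 1)
    (hA : ∀ i ∈ I, ∀ j ∈ I, hsInner (A i) (A j) = if i = j then 1 else 0) (x : Fin k × Fin k) :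
    ∑ i ∈ I, ‖star (u x.1) ⬝ᵥ A i *ᵥ u x.2‖ ^ 2 ≤ 1 := by
  have h := sum_norm_inner_sq_le I (fun i => hsVec (A i))
    (fun i hi j hj hij => by rw [inner_hsVec, hA i hi j hj, if_neg hij])
    (fun i hi => by
      have : ‖hsVec (A i)‖ ^ 2 = 1 := by
        rw [← @inner_self_eq_norm_sq ℂ, inner_hsVec, hA i hi i hi, if_pos rfl]; simp
      exact (sq_le_one_iff₀ (norm_nonneg _)).1 this.le)
    (hsVec (Matrix.vecMulVec (u x.1) (star (u x.2))))
  simp_rw [norm_inner_symm (hsVec (A _)), inner_hsVec_vecMulVec] at h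
  exact h.trans (pow_le_one₀ (norm_nonneg _) (norm_hsVec_vecMulVec_le (hu1 _) (hu1 _)))

/-- The roles are exchanged: the operators `|u_a⟩⟨u_b|` are orthogonal of norm at most one, tested
on the unit vector `A i`. -/
theorem sum_norm_sq_matrixElement_le_right (hu : ∀ a b, a ≠ b → star (u a) ⬝ᵥ u b = 0)
    (hu1 : ∀ a, (star (u a) ⬝ᵥ u a).re ≤ 1)
    (hA : ∀ i ∈ I, ∀ j ∈ I, hsInner (A i) (A j) = if i = j then 1 else 0) {i : ℕ} (hi : i ∈ I) :
    ∑ x : Fin k × Fin k, ‖star (u x.1) ⬝ᵥ A i *ᵥ u x.2‖ ^ 2 ≤ 1 := by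
  have h := sum_norm_inner_sq_le Finset.univ
    (fun x : Fin k × Fin k => hsVec (Matrix.vecMulVec (u x.1) (star (u x.2))))
    (fun x _ y _ hxy => by
      rw [inner_hsVec_vecMulVec_vecMulVec]
      by_cases h1 : x.1 = y.1
      · rw [hu y.2 x.2 fun h2 => hxy (Prod.ext h1 h2.symm), mul_zero]
      · rw [hu _ _ h1, zero_mul])
    (fun x _ => norm_hsVec_vecMulVec_le (hu1 _) (hu1 _)) (hsVec (A i))
  simp_rw [inner_hsVec_vecMulVec] at h
  refine h.trans (le_of_eq ?_)
  rw [← @inner_self_eq_norm_sq ℂ, inner_hsVec, hA i hi i hi, if_pos rfl]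
  simp

end Bessel

/-! ### Schmidt vectors and their expectation values -/

/-- The product vector `x ⊗ y`. -/
def tensorVec {m n : ℕ} (x : Fin m → ℂ) (y : Fin n → ℂ) : Fin m × Fin n → ℂ :=
  fun q => x q.1 * y q.2

/-- The vector `∑ s_a u_a ⊗ v_a`. -/
noncomputable def schmidtVec {m n k : ℕ} (s : Fin k → ℝ) (u : Fin k → Fin m → ℂ)
    (v : Fin k → Fin n → ℂ) : Fin m × Fin n → ℂ :=
  ∑ a, (s a : ℂ) • tensorVec (u a) (v a)

theorem schmidtVec_apply {m n k : ℕ} (s : Fin k → ℝ) (u : Fin k → Fin m → ℂ)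
    (v : Fin k → Fin n → ℂ) (x : Fin m) (y : Fin n) :
    schmidtVec s u v (x, y) = ∑ a, (s a : ℂ) * (u a x * v a y) := by
  simp [schmidtVec, tensorVec]

theorem star_tensorVec_dotProduct {m n : ℕ} (x x' : Fin m → ℂ) (y y' : Fin n → ℂ) :
    star (tensorVec x y) ⬝ᵥ tensorVec x' y' = (star x ⬝ᵥ x') * (star y ⬝ᵥ y') := by
  simp only [dotProduct, Fintype.sum_prod_type, Finset.sum_mul_sum, tensorVec, Pi.star_apply,
    star_mul']
  exact Finset.sum_congr rfl fun _ _ => Finset.sum_congr rfl fun _ _ => by ring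

theorem kronecker_mulVec_tensorVec {m n : ℕ} (A : Matrix (Fin m) (Fin m) ℂ)
    (B : Matrix (Fin n) (Fin n) ℂ) (x : Fin m → ℂ) (y : Fin n → ℂ) :
    (A ⊗ₖ B) *ᵥ tensorVec x y = tensorVec (A *ᵥ x) (B *ᵥ y) := by
  ext q
  simp only [Matrix.mulVec, dotProduct, Fintype.sum_prod_type, tensorVec, Finset.sum_mul_sum,
    Matrix.kroneckerMap_apply]
  exact Finset.sum_congr rfl fun _ _ => Finset.sum_congr rfl fun _ _ => by ring

theorem star_schmidtVec_dotProduct {m n k : ℕ} (s : Fin k → ℝ) (u : Fin k → Fin m → ℂ)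
    (v : Fin k → Fin n → ℂ) (φ : Fin m × Fin n → ℂ) :
    star (schmidtVec s u v) ⬝ᵥ φ = ∑ a, (s a : ℂ) * (star (tensorVec (u a) (v a)) ⬝ᵥ φ) := by
  rw [schmidtVec, star_sum, sum_dotProduct]
  refine Finset.sum_congr rfl fun a _ => ?_
  rw [star_smul, smul_dotProduct, smul_eq_mul]
  simp

theorem expectation_schmidtVec {m n k : ℕ} (s : Fin k → ℝ) (u : Fin k → Fin m → ℂ)
    (v : Fin k → Fin n → ℂ) (I : Finset ℕ) (μ : ℕ → ℝ) (A : ℕ → Matrix (Fin m) (Fin m) ℂ)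
    (B : ℕ → Matrix (Fin n) (Fin n) ℂ) :
    star (schmidtVec s u v) ⬝ᵥ (∑ i ∈ I, (μ i : ℂ) • (A i ⊗ₖ B i)) *ᵥ schmidtVec s u v =
      ∑ x : Fin k × Fin k, ((s x.1 * s x.2 : ℝ) : ℂ) * ∑ i ∈ I, (μ i : ℂ) *
        ((star (u x.1) ⬝ᵥ A i *ᵥ u x.2) * (star (v x.1) ⬝ᵥ B i *ᵥ v x.2)) := by
  rw [star_schmidtVec_dotProduct, Fintype.sum_prod_type]
  refine Finset.sum_congr rfl fun a _ => ?_
  rw [schmidtVec, Matrix.mulVec_sum, dotProduct_sum, Finset.mul_sum]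
  refine Finset.sum_congr rfl fun b _ => ?_
  rw [Matrix.mulVec_smul, dotProduct_smul, Matrix.sum_mulVec, dotProduct_sum, smul_eq_mul,
    ← mul_assoc]
  push_cast
  congr 1
  refine Finset.sum_congr rfl fun i _ => ?_
  rw [Matrix.smul_mulVec, dotProduct_smul, kronecker_mulVec_tensorVec, star_tensorVec_dotProduct,
    smul_eq_mul]

/-! ### Closed Schmidt forms, compactness and attainment -/

/-- Data presenting a unit vector as `∑ s_a u_a ⊗ v_a` with `s_a ≥ 0` and orthogonal families of
vectors, normalized wherever `s_a ≠ 0`. Unlike the condition of exact Schmidt rank, it is closed. -/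
structure IsSchmidtForm {m n k : ℕ} (s : Fin k → ℝ) (u : Fin k → Fin m → ℂ)
    (v : Fin k → Fin n → ℂ) : Prop where
  nonneg : ∀ a, 0 ≤ s a
  orthogonal_left : ∀ a b, a ≠ b → star (u a) ⬝ᵥ u b = 0
  orthogonal_right : ∀ a b, a ≠ b → star (v a) ⬝ᵥ v b = 0
  norm_left : ∀ a, (star (u a) ⬝ᵥ u a).re ≤ 1
  norm_right : ∀ a, (star (v a) ⬝ᵥ v a).re ≤ 1
  unit_left : ∀ a, (s a : ℂ) * (star (u a) ⬝ᵥ u a) = s a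
  unit_right : ∀ a, (s a : ℂ) * (star (v a) ⬝ᵥ v a) = s a
  sum_sq : ∑ a, s a ^ 2 = 1

theorem star_schmidtVec_self {m n k : ℕ} {s : Fin k → ℝ} {u : Fin k → Fin m → ℂ}
    {v : Fin k → Fin n → ℂ} (hu : ∀ a b, a ≠ b → star (u a) ⬝ᵥ u b = 0)
    (hu1 : ∀ a, (s a : ℂ) * (star (u a) ⬝ᵥ u a) = s a)
    (hv1 : ∀ a, (s a : ℂ) * (star (v a) ⬝ᵥ v a) = s a) :
    star (schmidtVec s u v) ⬝ᵥ schmidtVec s u v = ((∑ a, s a ^ 2 : ℝ) : ℂ) := by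
  rw [star_schmidtVec_dotProduct]
  push_cast
  refine Finset.sum_congr rfl fun a _ => ?_
  rw [schmidtVec, dotProduct_sum, Finset.sum_eq_single a]
  · rw [dotProduct_smul, star_tensorVec_dotProduct, smul_eq_mul, ← mul_assoc (s a : ℂ) (_ ⬝ᵥ _),
      hu1, hv1, sq]
  · intro b _ hb
    rw [dotProduct_smul, star_tensorVec_dotProduct, hu a b hb.symm, zero_mul, smul_zero]
  · simp

theorem IsSchmidtForm.mem_pureSchmidtStates {m n k : ℕ} {s : Fin k → ℝ} {u : Fin k → Fin m → ℂ}
    {v : Fin k → Fin n → ℂ} (h : IsSchmidtForm s u v) :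
    schmidtVec s u v ∈ pureSchmidtStates m n k := by
  refine ⟨by rw [star_schmidtVec_self h.orthogonal_left h.unit_left h.unit_right, h.sum_sq]; simp,
    Fintype.card {a // s a ≠ 0}, (Fintype.card_subtype_le _).trans_eq (Fintype.card_fin k), ?_⟩
  -- Only the nonzero coefficients are kept; there `unit_left` and `unit_right` force norm one.
  let f := (Fintype.equivFin {a // s a ≠ 0}).symm
  have hne : ∀ i, (s (f i) : ℂ) ≠ 0 := fun i => Complex.ofReal_ne_zero.2 (f i).2
  have hinj : ∀ i j, i ≠ j → (f i : Fin k) ≠ f j := fun i j hij h =>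
    hij (f.injective (Subtype.ext h))
  refine ⟨fun i => s (f i), fun i => u (f i), fun i => v (f i),
    fun i => lt_of_le_of_ne (h.nonneg _) (f i).2.symm, fun i j => ?_, fun i j => ?_,
    fun x y => ?_⟩
  · split_ifs with hij
    · subst hij
      exact mul_left_cancel₀ (hne i) ((h.unit_left _).trans (mul_one _).symm)
    · exact h.orthogonal_left _ _ (hinj i j hij)
  · split_ifs with hij
    · subst hij
      exact mul_left_cancel₀ (hne i) ((h.unit_right _).trans (mul_one _).symm)
    · exact h.orthogonal_right _ _ (hinj i j hij)
  · rw [schmidtVec_apply,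
      f.sum_comp (fun a : {a // s a ≠ 0} => (s a : ℂ) * (u a x * v a y)),
      ← Finset.sum_subtype (Finset.univ.filter fun a => s a ≠ 0) (by simp)
        (fun a => (s a : ℂ) * (u a x * v a y)), Finset.sum_filter]
    refine Finset.sum_congr rfl fun a _ => ?_
    split_ifs with ha
    · rfl
    · simp [not_not.1 ha]

/-- Padding with zero coefficients and zero vectors brings every rank up to exactly `k` terms, with
no need to extend the orthonormal families. -/
theorem exists_schmidtForm {m n k : ℕ} {ψ : Fin m × Fin n → ℂ}
    (hψ : ψ ∈ pureSchmidtStates m n k) :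
    ∃ (s : Fin k → ℝ) (u : Fin k → Fin m → ℂ) (v : Fin k → Fin n → ℂ),
      IsSchmidtForm s u v ∧ schmidtVec s u v = ψ := by
  obtain ⟨hunit, r, hr, s, u, v, hs, hu, hv, hψ⟩ := hψ
  have hψ' : ψ = schmidtVec s u v := by ext ⟨x, y⟩; rw [schmidtVec_apply, hψ]
  have hnorm := star_schmidtVec_self (s := s) (u := u) (v := v)
    (fun a b hab => by rw [hu, if_neg hab]) (fun a => by rw [hu, if_pos rfl, mul_one])
    (fun a => by rw [hv, if_pos rfl, mul_one])
  rw [← hψ', hunit] at hnorm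
  have hsum : ∑ a, s a ^ 2 = 1 := by exact_mod_cast hnorm.symm
  obtain ⟨t, rfl⟩ := Nat.exists_eq_add_of_le hr
  refine ⟨Fin.append s 0, Fin.append u 0, Fin.append v 0, ⟨?_, ?_, ?_, ?_, ?_, ?_, ?_, ?_⟩, ?_⟩
  · exact fun a => Fin.addCases (fun i => by simpa using (hs i).le) (fun i => by simp) a
  · intro a b
    induction a using Fin.addCases <;> induction b using Fin.addCases <;> simp [hu]
  · intro a b
    induction a using Fin.addCases <;> induction b using Fin.addCases <;> simp [hv]
  · intro a
    induction a using Fin.addCases <;> simp [hu]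
  · intro a
    induction a using Fin.addCases <;> simp [hv]
  · intro a
    induction a using Fin.addCases <;> simp [hu]
  · intro a
    induction a using Fin.addCases <;> simp [hv]
  · rw [Fin.sum_univ_add]; simpa using hsum
  · ext ⟨x, y⟩
    rw [schmidtVec_apply, Fin.sum_univ_add, hψ]
    simp

theorem exists_antitone_schmidtForm {m n k : ℕ} {ψ : Fin m × Fin n → ℂ}
    (hψ : ψ ∈ pureSchmidtStates m n k) :
    ∃ (s : Fin k → ℝ) (u : Fin k → Fin m → ℂ) (v : Fin k → Fin n → ℂ),
      Antitone s ∧ IsSchmidtForm s u v ∧ schmidtVec s u v = ψ := by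
  obtain ⟨s, u, v, h, rfl⟩ := exists_schmidtForm hψ
  let σ := Tuple.sort fun a => -s a
  refine ⟨s ∘ σ, u ∘ σ, v ∘ σ, fun a b hab => neg_le_neg_iff.1
    (Tuple.monotone_sort (fun a => -s a) hab), ⟨fun a => h.nonneg _,
    fun a b hab => h.orthogonal_left _ _ (σ.injective.ne hab),
    fun a b hab => h.orthogonal_right _ _ (σ.injective.ne hab), fun a => h.norm_left _,
    fun a => h.norm_right _, fun a => h.unit_left _, fun a => h.unit_right _,
    (Equiv.sum_comp σ fun a => s a ^ 2).trans h.sum_sq⟩,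
    Equiv.sum_comp σ fun a => (s a : ℂ) • tensorVec (u a) (v a)⟩

theorem norm_le_one_of_star_dotProduct_self {d : ℕ} {x : Fin d → ℂ}
    (hx : (star x ⬝ᵥ x).re ≤ 1) : ‖x‖ ≤ 1 := by
  rw [star_dotProduct_self_re] at hx
  refine (pi_norm_le_iff_of_nonneg zero_le_one).2 fun i =>
    (sq_le_one_iff₀ (norm_nonneg _)).1 (le_trans ?_ hx)
  exact Finset.single_le_sum (f := fun j => ‖x j‖ ^ 2) (fun j _ => sq_nonneg _) (Finset.mem_univ i)

/-- The Schmidt forms with `k` terms are cut out by closed conditions inside a unit ball, and the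
states are their continuous image. -/
theorem isCompact_pureSchmidtStates (m n k : ℕ) : IsCompact (pureSchmidtStates m n k) := by
  let Q : Set ((Fin k → ℝ) × (Fin k → Fin m → ℂ) × (Fin k → Fin n → ℂ)) :=
    {x | IsSchmidtForm x.1 x.2.1 x.2.2}
  have himage : pureSchmidtStates m n k = (fun x : (Fin k → ℝ) × (Fin k → Fin m → ℂ) ×
      (Fin k → Fin n → ℂ) => schmidtVec x.1 x.2.1 x.2.2) '' Q := by
    ext ψ
    constructor
    · intro hψ
      obtain ⟨s, u, v, h, rfl⟩ := exists_schmidtForm hψ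
      exact ⟨(s, u, v), h, rfl⟩
    · rintro ⟨x, h, rfl⟩
      exact IsSchmidtForm.mem_pureSchmidtStates h
  rw [himage]
  refine IsCompact.image ?_ ?_
  · refine Metric.isCompact_of_isClosed_isBounded ?_ ?_
    · have hQ : Q = {x | (∀ a, 0 ≤ x.1 a) ∧
          (∀ a b, a ≠ b → star (x.2.1 a) ⬝ᵥ x.2.1 b = 0) ∧
          (∀ a b, a ≠ b → star (x.2.2 a) ⬝ᵥ x.2.2 b = 0) ∧
          (∀ a, (star (x.2.1 a) ⬝ᵥ x.2.1 a).re ≤ 1) ∧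
          (∀ a, (star (x.2.2 a) ⬝ᵥ x.2.2 a).re ≤ 1) ∧
          (∀ a, (x.1 a : ℂ) * (star (x.2.1 a) ⬝ᵥ x.2.1 a) = x.1 a) ∧
          (∀ a, (x.1 a : ℂ) * (star (x.2.2 a) ⬝ᵥ x.2.2 a) = x.1 a) ∧ ∑ a, x.1 a ^ 2 = 1} := by
        ext x
        exact ⟨fun ⟨h1, h2, h3, h4, h5, h6, h7, h8⟩ => ⟨h1, h2, h3, h4, h5, h6, h7, h8⟩,
          fun ⟨h1, h2, h3, h4, h5, h6, h7, h8⟩ => ⟨h1, h2, h3, h4, h5, h6, h7, h8⟩⟩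
      rw [hQ]
      simp only [Set.ofPred_and, Set.ofPred_forall, dotProduct]
      refine IsClosed.inter ?_ (IsClosed.inter ?_ (IsClosed.inter ?_ (IsClosed.inter ?_
        (IsClosed.inter ?_ (IsClosed.inter ?_ (IsClosed.inter ?_ ?_))))))
      · exact isClosed_iInter fun a => isClosed_le (by fun_prop) (by fun_prop)
      · exact isClosed_iInter fun a => isClosed_iInter fun b => isClosed_iInter fun _ =>
          isClosed_eq (by fun_prop) (by fun_prop)
      · exact isClosed_iInter fun a => isClosed_iInter fun b => isClosed_iInter fun _ =>
          isClosed_eq (by fun_prop) (by fun_prop)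
      · exact isClosed_iInter fun a => isClosed_le (by fun_prop) (by fun_prop)
      · exact isClosed_iInter fun a => isClosed_le (by fun_prop) (by fun_prop)
      · exact isClosed_iInter fun a => isClosed_eq (by fun_prop) (by fun_prop)
      · exact isClosed_iInter fun a => isClosed_eq (by fun_prop) (by fun_prop)
      · exact isClosed_eq (by fun_prop) (by fun_prop)
    · refine (Metric.isBounded_closedBall (x := 0) (r := 1)).subset fun x hx => ?_
      have hx : IsSchmidtForm x.1 x.2.1 x.2.2 := hx
      rw [mem_closedBall_zero_iff, Prod.norm_def, Prod.norm_def]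
      refine max_le ?_ (max_le ?_ ?_)
      · refine (pi_norm_le_iff_of_nonneg zero_le_one).2 fun a =>
          (sq_le_one_iff₀ (norm_nonneg _)).1 ?_
        rw [← hx.sum_sq, Real.norm_eq_abs, sq_abs]
        exact Finset.single_le_sum (f := fun a => x.1 a ^ 2) (fun a _ => sq_nonneg _)
          (Finset.mem_univ a)
      · exact (pi_norm_le_iff_of_nonneg zero_le_one).2 fun a =>
          norm_le_one_of_star_dotProduct_self (hx.norm_left a)
      · exact (pi_norm_le_iff_of_nonneg zero_le_one).2 fun a =>
          norm_le_one_of_star_dotProduct_self (hx.norm_right a)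
  · refine continuous_pi fun ⟨x, y⟩ => ?_
    simp only [schmidtVec_apply]
    fun_prop

theorem pureSchmidtStates_nonempty {m n k : ℕ} (hm : 0 < m) (hn : 0 < n) (hk : 0 < k) :
    (pureSchmidtStates m n k).Nonempty := by
  have hform : IsSchmidtForm (k := 1) (fun _ => 1) (fun _ => Pi.single (⟨0, hm⟩ : Fin m) (1 : ℂ))
      (fun _ => Pi.single (⟨0, hn⟩ : Fin n) (1 : ℂ)) := by
    constructor <;> simp
  obtain ⟨h1, r, hr, h2⟩ := hform.mem_pureSchmidtStates
  exact ⟨_, h1, r, hr.trans hk, h2⟩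

theorem schmidtExpectations_eq_image {m n : ℕ} (k : ℕ)
    (X : Matrix (Fin m × Fin n) (Fin m × Fin n) ℂ) :
    schmidtExpectations k X = (fun ψ => (star ψ ⬝ᵥ X *ᵥ ψ).re) '' pureSchmidtStates m n k := by
  ext x
  exact ⟨fun ⟨ψ, h, hx⟩ => ⟨ψ, h, hx.symm⟩, fun ⟨ψ, h, hx⟩ => ⟨ψ, h, hx.symm⟩⟩

theorem isGreatest_optimalCoeff {m n k : ℕ} (hm : 0 < m) (hn : 0 < n) (hk : 0 < k)
    (X : Matrix (Fin m × Fin n) (Fin m × Fin n) ℂ) :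
    IsGreatest (schmidtExpectations k X) (optimalCoeff k X) := by
  have hc : IsCompact (schmidtExpectations k X) := by
    rw [schmidtExpectations_eq_image]
    refine (isCompact_pureSchmidtStates m n k).image ?_
    simp only [dotProduct, Matrix.mulVec]
    fun_prop
  refine hc.isGreatest_sSup ?_
  rw [schmidtExpectations_eq_image]
  exact (pureSchmidtStates_nonempty hm hn hk).image _

/-! ### The bound for pure states -/

/-- The bound `θ` on the expectation values over states of Schmidt rank at most `k`. -/
theorem expectation_le_thetaCoeff {m n k : ℕ} (hmn : m ≤ n) (hk : 2 ≤ k) (hkm : k ≤ m)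
    {X : Matrix (Fin m × Fin n) (Fin m × Fin n) ℂ} {μ : ℕ → ℝ}
    (hμ : IsOperatorSchmidtCoefficients X μ) {ψ : Fin m × Fin n → ℂ}
    (hψ : ψ ∈ pureSchmidtStates m n k) : (star ψ ⬝ᵥ X *ᵥ ψ).re ≤ thetaCoeff k μ := by
  obtain ⟨A, B, hAB⟩ := hμ
  obtain ⟨s, u, v, hs, h, rfl⟩ := exists_antitone_schmidtForm hψ
  -- `T` dominates the real part of each term; by `hT` its row and column sums are at most averages
  -- of two Bessel sums.
  let T : Fin k × Fin k → ℕ → ℝ := fun x i =>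
    ‖star (u x.1) ⬝ᵥ A i *ᵥ u x.2‖ * ‖star (v x.1) ⬝ᵥ B i *ᵥ v x.2‖
  have hT : ∀ x i, T x i ≤ ‖star (u x.1) ⬝ᵥ A i *ᵥ u x.2‖ ^ 2 / 2 +
      ‖star (v x.1) ⬝ᵥ B i *ᵥ v x.2‖ ^ 2 / 2 := fun x i => by
    linarith [two_mul_le_add_sq ‖star (u x.1) ⬝ᵥ A i *ᵥ u x.2‖ ‖star (v x.1) ⬝ᵥ B i *ᵥ v x.2‖]
  have hmM : k ^ 2 ≤ min (m ^ 2) (n ^ 2) :=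
    le_min (Nat.pow_le_pow_left hkm 2) (Nat.pow_le_pow_left (hkm.trans hmn) 2)
  have key := coupling_le_theta hk hmM hs h.nonneg hAB.nonneg hAB.antitone (T := T)
    (fun x i => mul_nonneg (norm_nonneg _) (norm_nonneg _))
    (fun x => by
      refine (Finset.sum_le_sum fun i _ => hT x i).trans ?_
      rw [Finset.sum_add_distrib, ← Finset.sum_div, ← Finset.sum_div]
      linarith [sum_norm_sq_matrixElement_le_left h.norm_left hAB.orthonormal_left x,
        sum_norm_sq_matrixElement_le_left h.norm_right hAB.orthonormal_right x])
    (fun i hi => by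
      refine (Finset.sum_le_sum fun x _ => hT x i).trans ?_
      rw [Finset.sum_add_distrib, ← Finset.sum_div, ← Finset.sum_div]
      linarith [sum_norm_sq_matrixElement_le_right h.orthogonal_left h.norm_left
          hAB.orthonormal_left hi,
        sum_norm_sq_matrixElement_le_right h.orthogonal_right h.norm_right
          hAB.orthonormal_right hi])
  rw [h.sum_sq, mul_one] at key
  refine le_trans ?_ key
  rw [hAB.eq_sum, expectation_schmidtVec, Complex.re_sum]
  refine Finset.sum_le_sum fun x _ => ?_
  rw [Complex.re_ofReal_mul, Complex.re_sum]
  refine mul_le_mul_of_nonneg_left (Finset.sum_le_sum fun i hi => ?_)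
    (mul_nonneg (h.nonneg _) (h.nonneg _))
  rw [Complex.re_ofReal_mul]
  exact mul_le_mul_of_nonneg_left ((Complex.re_le_norm _).trans_eq (norm_mul _ _))
    (hAB.nonneg i hi)

/-! ### Mixed states and witnesses -/

theorem trace_mul_mixture {m n N : ℕ} (W : Matrix (Fin m × Fin n) (Fin m × Fin n) ℂ)
    (p : Fin N → ℝ) (ψ : Fin N → Fin m × Fin n → ℂ) :
    (W * ∑ i, (p i : ℂ) • Matrix.vecMulVec (ψ i) (star (ψ i))).trace.re =
      ∑ i, p i * (star (ψ i) ⬝ᵥ W *ᵥ ψ i).re := by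
  rw [Matrix.mul_sum, Matrix.trace_sum, Complex.re_sum]
  refine Finset.sum_congr rfl fun i _ => ?_
  rw [Matrix.mul_smul, Matrix.trace_smul, Matrix.mul_vecMulVec, Matrix.trace_vecMulVec,
    dotProduct_comm, smul_eq_mul, Complex.re_ofReal_mul]

theorem vecMulVec_mem_schmidtStates {m n k : ℕ} {ψ : Fin m × Fin n → ℂ}
    (hψ : ψ ∈ pureSchmidtStates m n k) :
    Matrix.vecMulVec ψ (star ψ) ∈ schmidtStates m n k :=
  ⟨1, fun _ => 1, fun _ => ψ, fun _ => zero_le_one, by simp, fun _ => hψ, by simp⟩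

theorem trace_schmidtState {m n k : ℕ} {ρ : Matrix (Fin m × Fin n) (Fin m × Fin n) ℂ}
    (hρ : ρ ∈ schmidtStates m n k) : ρ.trace.re = 1 := by
  obtain ⟨N, p, ψ, hp, hp1, hψ, rfl⟩ := hρ
  have h := trace_mul_mixture 1 p ψ
  rw [Matrix.one_mul] at h
  rw [h, ← hp1]
  refine Finset.sum_congr rfl fun i _ => ?_
  rw [Matrix.one_mulVec, (hψ i).1, Complex.one_re, mul_one]

theorem trace_sub_mul {m n k : ℕ} (c : ℝ) (X : Matrix (Fin m × Fin n) (Fin m × Fin n) ℂ)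
    {ρ : Matrix (Fin m × Fin n) (Fin m × Fin n) ℂ} (hρ : ρ ∈ schmidtStates m n k) :
    (((c : ℂ) • (1 : Matrix (Fin m × Fin n) (Fin m × Fin n) ℂ) - X) * ρ).trace.re =
      c - (X * ρ).trace.re := by
  rw [Matrix.sub_mul, Matrix.trace_sub, Complex.sub_re, Matrix.smul_mul, Matrix.one_mul,
    Matrix.trace_smul, smul_eq_mul, Complex.re_ofReal_mul, trace_schmidtState hρ, mul_one]

/-- Pure states are themselves in `S_k`, and the expectation of a mixture is a convex combination of
pure ones. -/
theorem nonnegOnSchmidtStates_iff {m n k : ℕ} (c : ℝ)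
    (X : Matrix (Fin m × Fin n) (Fin m × Fin n) ℂ) :
    NonnegOnSchmidtStates k ((c : ℂ) • (1 : Matrix (Fin m × Fin n) (Fin m × Fin n) ℂ) - X) ↔
      ∀ ψ ∈ pureSchmidtStates m n k, (star ψ ⬝ᵥ X *ᵥ ψ).re ≤ c := by
  constructor
  · intro h ψ hψ
    have hρ := vecMulVec_mem_schmidtStates hψ
    have h' := h _ hρ
    rwa [trace_sub_mul c X hρ, Matrix.mul_vecMulVec, Matrix.trace_vecMulVec, dotProduct_comm,
      sub_nonneg] at h'
  · intro h ρ hρ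
    rw [trace_sub_mul c X hρ, sub_nonneg]
    obtain ⟨N, p, ψ, hp, hp1, hψ, rfl⟩ := hρ
    rw [trace_mul_mixture]
    calc ∑ i, p i * (star (ψ i) ⬝ᵥ X *ᵥ ψ i).re ≤ ∑ i, p i * c :=
          Finset.sum_le_sum fun i _ => mul_le_mul_of_nonneg_left (h _ (hψ i)) (hp i)
      _ = c := by rw [← Finset.sum_mul, hp1, one_mul]

theorem isSchmidtWitness_iff {m n k : ℕ} {c : ℝ}
    {X : Matrix (Fin m × Fin n) (Fin m × Fin n) ℂ} (hX : X.IsHermitian)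
    (hc : NonnegOnSchmidtStates k
      ((c : ℂ) • (1 : Matrix (Fin m × Fin n) (Fin m × Fin n) ℂ) - X)) :
    IsSchmidtWitness (k + 1)
        ((c : ℂ) • (1 : Matrix (Fin m × Fin n) (Fin m × Fin n) ℂ) - X) ↔
      ∃ ρ ∈ schmidtStates m n (k + 1), c < (X * ρ).trace.re := by
  have hherm : ((c : ℂ) • (1 : Matrix (Fin m × Fin n) (Fin m × Fin n) ℂ) - X).IsHermitian := by
    refine Matrix.IsHermitian.sub ?_ hX
    rw [Matrix.IsHermitian, Matrix.conjTranspose_smul, Matrix.conjTranspose_one]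
    simp
  constructor
  · rintro ⟨-, -, ρ, hρ, h⟩
    rw [trace_sub_mul c X hρ, sub_neg] at h
    exact ⟨ρ, hρ, h⟩
  · rintro ⟨ρ, hρ, h⟩
    exact ⟨hherm, hc, ρ, hρ, by rwa [trace_sub_mul c X hρ, sub_neg]⟩

theorem mainTheorem1 (m n k : ℕ) (hm : 5 ≤ m) (hmn : m ≤ n) (hk : 2 ≤ k) (hkm : k ≤ m)
    (X : Matrix (Fin m × Fin n) (Fin m × Fin n) ℂ) (hX : X.IsHermitian)
    (μ : ℕ → ℝ) (hμ : IsOperatorSchmidtCoefficients X μ) :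
    -- the maximum defining the optimal coefficient is attained
    IsGreatest (schmidtExpectations k X) (optimalCoeff k X) ∧
    -- it is the least `c` for which `c I - X` is nonnegative on `S_k`
    (∀ c : ℝ, NonnegOnSchmidtStates k
      ((c : ℂ) • (1 : Matrix (Fin m × Fin n) (Fin m × Fin n) ℂ) - X) ↔ optimalCoeff k X ≤ c) ∧
    (IsSchmidtWitness (k + 1)
        ((optimalCoeff k X : ℂ) • (1 : Matrix (Fin m × Fin n) (Fin m × Fin n) ℂ) - X) ↔
      ∃ ρ ∈ schmidtStates m n (k + 1), optimalCoeff k X < (X * ρ).trace.re) ∧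
    -- the bound
    optimalCoeff k X ≤ thetaCoeff k μ ∧
    -- the constructed witness
    NonnegOnSchmidtStates k
      ((thetaCoeff k μ : ℂ) • (1 : Matrix (Fin m × Fin n) (Fin m × Fin n) ℂ) - X) ∧
    (IsSchmidtWitness (k + 1)
        ((thetaCoeff k μ : ℂ) • (1 : Matrix (Fin m × Fin n) (Fin m × Fin n) ℂ) - X) ↔
      ∃ ρ ∈ schmidtStates m n (k + 1), thetaCoeff k μ < (X * ρ).trace.re) := by
  have hmax := isGreatest_optimalCoeff (by omega : 0 < m) (by omega : 0 < n) (by omega : 0 < k) X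
  have hiff : ∀ c : ℝ, NonnegOnSchmidtStates k
      ((c : ℂ) • (1 : Matrix (Fin m × Fin n) (Fin m × Fin n) ℂ) - X) ↔ optimalCoeff k X ≤ c := by
    intro c
    rw [nonnegOnSchmidtStates_iff]
    constructor
    · intro h
      obtain ⟨ψ, hψ, hval⟩ := hmax.1
      exact hval ▸ h ψ hψ
    · exact fun h ψ hψ => (hmax.2 ⟨ψ, hψ, rfl⟩).trans h
  -- Nonnegativity of `θ I - X` comes from the pure-state bound; `λ ≤ θ` is then its translation by
  -- `hiff`.
  have htheta : NonnegOnSchmidtStates k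
      ((thetaCoeff k μ : ℂ) • (1 : Matrix (Fin m × Fin n) (Fin m × Fin n) ℂ) - X) :=
    (nonnegOnSchmidtStates_iff _ _).2 fun ψ hψ => expectation_le_thetaCoeff hmn hk hkm hμ hψ
  exact ⟨hmax, hiff, isSchmidtWitness_iff hX ((hiff _).2 le_rfl), (hiff _).1 htheta, htheta,
    isSchmidtWitness_iff hX htheta⟩
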